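/- Let $(\Omega,\mathcal F,(\mathcal F_t)_{t\ge 0},\mathbb P)$ be a filtered probability space, $W=(W_t)_{t\ge0}$ a standard real Brownian motion on it, and $T=(T_t)_{t\ge 0}$ a continuous random time change independent of $W$: a non-decreasing process with continuous paths and values in $[0,\infty]$ such that every $T_t$ is an $(\mathcal F_t)$-stopping time. Assume that, almost surely, $T_0=0$ and $T_t<\infty$ for all $t\ge0$, and put $X_t=W_{T_t}$. For $n\in\mathbb N$ and $t\ge 0$ let $$[X]^n_t=\sum_{i=1}^{\lfloor nt\rfloor}\bigl(X_{i/n}-X_{(i-1)/n}\bigr)^2$$ be the realized variation of $X$. For $s,t\ge0$ and $u,v\in[0,1]$ let $$\psi(s,t;u,v)=\begin{cases}\displaystyle\int_0^u\Phi\!\left(\frac{\sqrt{t\vee s}\,\Phi^{-1}(v)-\sqrt{s\wedge t}\,\Phi^{-1}(w)}{\sqrt{|t-s|}}\right)dw,&|t-s|>0,\\ u\wedge v,& t=s>0,\\ uv,&\text{otherwise,}\end{cases}$$ where $\Phi$ is the standard normal distribution function, with $\Phi(-\infty)=0$, $\Phi(\infty)=1$, $\Phi^{-1}(0)=-\infty$,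 $\Phi^{-1}(1)=\infty$. Define $C(s,t;u,v)=\psi(T_s,T_t;u,v)$ and $C^n(s,t;u,v)=\psi([X]^n_s,[X]^n_t;u,v)$. Let $t_0\ge0$ be such that $\mathbb P(T_{t_0}>0)=1$. Then for all $u,v\in[0,1]$, $\mathscr T>t_0$ and $\varepsilon>0$, $$\lim_{n\to\infty}\mathbb P\Bigl(\sup_{t_0\le s,t\le\mathscr T}\bigl|C(s,t;u,v)-C^n(s,t;u,v)\bigr|\ge\varepsilon\Bigr)=0.$$ -/

import Mathlib

open MeasureTheory ProbabilityTheory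
open scoped NNReal ENNReal Topology

noncomputable section

namespace TimeChangedBM

/-- `T` is a continuous random time change with respect to the filtration `𝓕`: a `[0, ∞]`-valued
process with (almost surely) non-decreasing continuous paths such that every `T t` is an
`𝓕`-stopping time. -/
structure IsContinuousTimeChange {Ω : Type*} {mΩ : MeasurableSpace Ω}
    (𝓕 : Filtration ℝ≥0 mΩ) (P : Measure Ω) (T : ℝ≥0 → Ω → ℝ≥0∞) : Prop where
  isStoppingTime : ∀ t, IsStoppingTime 𝓕 (T t)
  monotone : ∀ᵐ ω ∂P, Monotone (fun t ↦ T t ω)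
  continuous : ∀ᵐ ω ∂P, Continuous (fun t ↦ T t ω)

/-- The time-changed process `X t = W (T t)`, for time changes that are finite
almost surely (the value on the event `T t = ∞` is irrelevant). -/
def timeChanged {Ω : Type*} (W : ℝ≥0 → Ω → ℝ) (T : ℝ≥0 → Ω → ℝ≥0∞) (t : ℝ≥0) (ω : Ω) : ℝ :=
  W (T t ω).toNNReal ω

/-- The standard normal distribution function `Φ`, on the extended real line:
`Φ x = γ (-∞, x]`, so that `Φ (-∞) = 0` and `Φ (+∞) = 1`. -/
def stdNormalCDF (x : EReal) : ℝ :=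
  (gaussianReal 0 1).real {y : ℝ | (y : EReal) ≤ x}

/-- The inverse `Φ⁻¹ : [0, 1] → [-∞, ∞]`, with `Φ⁻¹ 0 = -∞` and `Φ⁻¹ 1 = +∞`. -/
def stdNormalQuantile (p : ℝ) : EReal :=
  sInf {x : EReal | p ≤ stdNormalCDF x}

/-- The function `ψ (s, t; u, v)`, for `0 ≤ s, t` and `u, v ∈ [0, 1]`: the copula of Brownian
motion at the times `s` and `t`. The argument of `Φ` is computed in the extended reals. -/
def psi (s t u v : ℝ) : ℝ :=
  if 0 < |t - s| then
    ∫ w in (0 : ℝ)..u, stdNormalCDF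
      (((√(max t s) : ℝ) * stdNormalQuantile v - (√(min s t) : ℝ) * stdNormalQuantile w) /
        (√|t - s| : ℝ))
  else if t = s ∧ 0 < s then min u v
  else u * v

/-- The realized variation `[Z]ⁿ_t = ∑_{i=1}^{⌊nt⌋} (Z_{i/n} - Z_{(i-1)/n})²`. -/
def realizedVariation {Ω : Type*} (Z : ℝ≥0 → Ω → ℝ) (n : ℕ) (t : ℝ≥0) (ω : Ω) : ℝ :=
  ∑ i ∈ Finset.range ⌊(n : ℝ≥0) * t⌋₊,
    (Z (((i + 1 : ℕ) : ℝ≥0) / (n : ℝ≥0)) ω - Z ((i : ℝ≥0) / (n : ℝ≥0)) ω) ^ 2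

/-- The conditional copula `C (s, t; u, v) = ψ (T_s, T_t; u, v)` of `X t = W (T t)`. -/
def condCopula {Ω : Type*} (T : ℝ≥0 → Ω → ℝ≥0∞) (s t : ℝ≥0) (u v : ℝ) (ω : Ω) : ℝ :=
  psi (T s ω).toReal (T t ω).toReal u v

/-- The plug-in estimator `Cⁿ (s, t; u, v) = ψ ([X]ⁿ_s, [X]ⁿ_t; u, v)`. -/
def copulaEstimator {Ω : Type*} (X : ℝ≥0 → Ω → ℝ) (n : ℕ) (s t : ℝ≥0) (u v : ℝ) (ω : Ω) : ℝ :=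
  psi (realizedVariation X n s ω) (realizedVariation X n t ω) u v

end TimeChangedBM

end

namespace TimeChangedBM

open Filter

/-! The estimator is a plug-in, so two facts suffice: ψ(·,·;u,v) is continuous on the open positive
quadrant, and [X]ⁿ converges to T in probability, uniformly on compact time intervals.

Continuity (`continuousOn_psi`) follows by dominated convergence, since the integrand lies in [0,1]
and is continuous in (s,t) for almost every w. The delicate points are those with s = t: there the
argument of Φ tends to +∞ or -∞ according to whether w < v or w > v. The integrand therefore tends
to the indicator of w < v, whose integral is u ∧ v.

For convergence at a fixed time (`tendsto_measure_realizedVariation_sub`), independence allows T to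
be frozen. Squared Brownian increments over a grid τ are independent with means Δτ and variances a
constant times (Δτ)², so Chebyshev bounds the error by a multiple of ∑(ΔT)², which vanishes because
T is continuous and monotone. Monotonicity of [X]ⁿ and T makes this locally uniform
(`tendsto_measure_exists_le_abs_sub`).

Finally, T_{t₀} > 0 confines T on [t₀, 𝒯], with high probability, to a compact subset of (0,∞),
where ψ is uniformly continuous (`tendsto_measure_exists_le_abs_sub_comp`). -/

/-! ### The normal distribution function and its quantile. -/

lemma stdNormalCDF_mono : Monotone stdNormalCDF := fun x y h ↦
  measureReal_mono (fun z (hz : (z : EReal) ≤ x) ↦ hz.trans h)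

lemma stdNormalCDF_nonneg (x : EReal) : 0 ≤ stdNormalCDF x := measureReal_nonneg

lemma stdNormalCDF_le_one (x : EReal) : stdNormalCDF x ≤ 1 := measureReal_le_one

lemma stdNormalCDF_coe (x : ℝ) : stdNormalCDF x = cdf (gaussianReal 0 1) x := by
  rw [cdf_eq_real, stdNormalCDF]
  congr 1
  ext y
  simp

lemma stdNormalCDF_bot : stdNormalCDF ⊥ = 0 := by simp [stdNormalCDF]

lemma stdNormalCDF_top : stdNormalCDF ⊤ = 1 := by simp [stdNormalCDF]

lemma continuous_stdNormalCDF_coe : Continuous fun x : ℝ ↦ stdNormalCDF x := by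
  rw [continuous_iff_continuousAt]
  intro x
  have := nullSingletonClass_gaussianReal (μ := 0) (v := 1) one_ne_zero
  have h : Tendsto (fun y : ℝ ↦ gaussianReal 0 1 (Set.Iic y)) (𝓝 x)
      (𝓝 (gaussianReal 0 1 (Set.Iic x))) := by
    -- The Gaussian law has no atom at x, the only point where the indicators of the half-lines may
    -- fail to converge.
    refine tendsto_measure_of_ae_tendsto_indicator_of_isFiniteMeasure _ measurableSet_Iic
      (fun _ ↦ measurableSet_Iic) ?_
    filter_upwards [Measure.ae_ne (gaussianReal 0 1) x] with z hz
    rcases lt_or_gt_of_ne hz with hz | hz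
    · filter_upwards [lt_mem_nhds hz] with y hy
      simp [hy.le, hz.le]
    · filter_upwards [gt_mem_nhds hz] with y hy
      simp [not_le.2 hy, not_le.2 hz]
  have h' := (ENNReal.tendsto_toReal (measure_ne_top _ _)).comp h
  have e : ∀ y : ℝ, stdNormalCDF y = (gaussianReal 0 1 (Set.Iic y)).toReal := fun y ↦ by
    rw [stdNormalCDF_coe, cdf_eq_real]; rfl
  simpa only [ContinuousAt, e, Function.comp_def] using h'

lemma tendsto_stdNormalCDF_atTop : Tendsto (fun x : ℝ ↦ stdNormalCDF x) atTop (𝓝 1) := by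
  simpa only [stdNormalCDF_coe] using tendsto_cdf_atTop (gaussianReal 0 1)

lemma tendsto_stdNormalCDF_atBot : Tendsto (fun x : ℝ ↦ stdNormalCDF x) atBot (𝓝 0) := by
  simpa only [stdNormalCDF_coe] using tendsto_cdf_atBot (gaussianReal 0 1)

lemma stdNormalQuantile_mono : Monotone stdNormalQuantile := fun _ _ h ↦
  sInf_le_sInf fun _ hx ↦ h.trans hx

lemma exists_stdNormalQuantile_eq {p : ℝ} (hp : p ∈ Set.Ioo (0 : ℝ) 1) :
    ∃ a : ℝ, stdNormalQuantile p = a ∧ stdNormalCDF a = p := by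
  obtain ⟨y, hy⟩ := (tendsto_stdNormalCDF_atBot.eventually (gt_mem_nhds hp.1)).exists
  obtain ⟨y', hy'⟩ := (tendsto_stdNormalCDF_atTop.eventually (lt_mem_nhds hp.2)).exists
  obtain ⟨x, hx⟩ : ∃ x : ℝ, stdNormalCDF x = p := by
    have := isPreconnected_univ.intermediate_value (Set.mem_univ y) (Set.mem_univ y')
      continuous_stdNormalCDF_coe.continuousOn ⟨hy.le, hy'.le⟩
    simpa using this
  have lower : ∀ z : ℝ, stdNormalCDF z < p → (z : EReal) ≤ stdNormalQuantile p := fun z hz ↦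
    le_sInf fun w hw ↦ le_of_not_gt fun hwz ↦
      (hz.trans_le (le_trans hw (stdNormalCDF_mono hwz.le))).false
  have hle : stdNormalQuantile p ≤ x := sInf_le hx.ge
  have hbot : stdNormalQuantile p ≠ ⊥ := fun h ↦ by
    have := lower y hy
    simp [h] at this
  have htop : stdNormalQuantile p ≠ ⊤ := fun h ↦ by simp [h] at hle
  have ha := EReal.coe_toReal htop hbot
  refine ⟨_, ha.symm, le_antisymm ?_ ?_⟩
  · rw [ha]
    exact (stdNormalCDF_mono hle).trans_eq hx
  -- If Φ were below p at the quantile, continuity would keep it below p slightly to the right,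
  -- against `lower`.
  · by_contra! hlt
    have hev := continuous_stdNormalCDF_coe.continuousAt.eventually (gt_mem_nhds hlt)
    have hev' := (hev.filter_mono nhdsWithin_le_nhds).and
      (self_mem_nhdsWithin (s := Set.Ioi (stdNormalQuantile p).toReal))
    obtain ⟨z, hz, hz'⟩ := hev'.exists
    have := lower z hz
    rw [← ha, EReal.coe_le_coe_iff] at this
    exact absurd hz' (not_lt.2 this)

lemma stdNormalQuantile_zero : stdNormalQuantile 0 = ⊥ :=
  le_bot_iff.1 (sInf_le stdNormalCDF_bot.ge)

lemma stdNormalQuantile_one : stdNormalQuantile 1 = ⊤ := by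
  refine top_le_iff.1 (le_of_forall_lt fun z hz ↦ ?_)
  obtain ⟨r, hr⟩ | h : (∃ r : ℝ, z ≤ r) ∨ z = ⊤ := by
    induction z with
    | bot => exact .inl ⟨0, by simp⟩
    | coe r => exact .inl ⟨r, le_rfl⟩
    | top => exact .inr rfl
  · have hr1 : stdNormalCDF (r + 1 : ℝ) < 1 := by
      rw [stdNormalCDF_coe, cdf_eq_real, ← not_le]
      intro h
      have h1 : (gaussianReal 0 1).real (Set.Iic (r + 1))ᶜ = 0 := by
        rw [probReal_compl_eq_one_sub measurableSet_Iic]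
        have := measureReal_le_one (μ := gaussianReal 0 1) (s := Set.Iic (r + 1))
        linarith
      rw [Set.compl_Iic, measureReal_eq_zero_iff] at h1
      -- Lebesgue measure is absolutely continuous with respect to the Gaussian law, so a half-line
      -- would be Lebesgue null.
      have h2 := gaussianReal_absolutelyContinuous' 0 one_ne_zero h1
      simp at h2
    have : ((r + 1 : ℝ) : EReal) ≤ stdNormalQuantile 1 :=
      le_sInf fun w hw ↦ le_of_not_gt fun hwz ↦
        (hr1.trans_le (le_trans hw (stdNormalCDF_mono hwz.le))).false
    refine lt_of_lt_of_le (lt_of_le_of_lt hr ?_) this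
    exact_mod_cast lt_add_one r
  · exact absurd hz (by simp [h])

/-! ### Continuity of ψ on the positive quadrant. -/

/-- At v = 0 the quantile is infinite, so the real-valued integrand used for 0 < v < 1 is not
available. Positivity of t excludes the product 0 · ∞, and Φ is evaluated at -∞ for every w in
(0,1). -/
lemma psi_zero_right {s t : ℝ} (ht : 0 < t) (u : ℝ) (hu : 0 ≤ u) (hu1 : u ≤ 1) :
    psi s t u 0 = 0 := by
  have key : ∀ w ∈ Set.Ioo (0 : ℝ) 1, 0 < |t - s| → stdNormalCDF
      (((√(max t s) : ℝ) * stdNormalQuantile 0 - (√(min s t) : ℝ) * stdNormalQuantile w) /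
        (√|t - s| : ℝ)) = 0 := fun w hw h ↦ by
    obtain ⟨b, hb, -⟩ := exists_stdNormalQuantile_eq hw
    rw [stdNormalQuantile_zero, hb, EReal.coe_mul_bot_of_pos (by positivity), ← EReal.coe_mul,
      EReal.bot_sub, EReal.bot_div_of_pos_ne_top (by exact_mod_cast Real.sqrt_pos.2 h)
        (EReal.coe_ne_top _), stdNormalCDF_bot]
  unfold psi
  split_ifs with h h'
  · rw [intervalIntegral.integral_congr_ae (g := fun _ ↦ 0), intervalIntegral.integral_zero]
    filter_upwards [Measure.ae_ne volume (1 : ℝ)] with w hw1 hw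
    rw [Set.uIoc_of_le hu] at hw
    exact key w ⟨hw.1, lt_of_le_of_ne (hw.2.trans hu1) hw1⟩ h
  · exact min_eq_right hu
  · simp

lemma psi_one_right {s t : ℝ} (ht : 0 < t) (u : ℝ) (hu : 0 ≤ u) (hu1 : u ≤ 1) :
    psi s t u 1 = u := by
  have key : ∀ w ∈ Set.Ioo (0 : ℝ) 1, 0 < |t - s| → stdNormalCDF
      (((√(max t s) : ℝ) * stdNormalQuantile 1 - (√(min s t) : ℝ) * stdNormalQuantile w) /
        (√|t - s| : ℝ)) = 1 := fun w hw h ↦ by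
    obtain ⟨b, hb, -⟩ := exists_stdNormalQuantile_eq hw
    rw [stdNormalQuantile_one, hb, EReal.coe_mul_top_of_pos (by positivity), ← EReal.coe_mul,
      EReal.top_sub_coe, EReal.top_div_of_pos_ne_top (by exact_mod_cast Real.sqrt_pos.2 h)
        (EReal.coe_ne_top _), stdNormalCDF_top]
  unfold psi
  split_ifs with h h'
  · rw [intervalIntegral.integral_congr_ae (g := fun _ ↦ 1)]
    · simp
    filter_upwards [Measure.ae_ne volume (1 : ℝ)] with w hw1 hw
    rw [Set.uIoc_of_le hu] at hw
    exact key w ⟨hw.1, lt_of_le_of_ne (hw.2.trans hu1) hw1⟩ h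
  · exact min_eq_left hu1
  · simp

/-- The integrand of `psi`, in real arithmetic, with its limit on the diagonal. -/
noncomputable def psiIntegrand (v : ℝ) (p : ℝ × ℝ) (w : ℝ) : ℝ :=
  if p.1 = p.2 then if w < v then 1 else 0
  else stdNormalCDF (((√(max p.2 p.1) * (stdNormalQuantile v).toReal -
    √(min p.1 p.2) * (stdNormalQuantile w).toReal) / √|p.2 - p.1| : ℝ) : EReal)

lemma psiIntegrand_mem_Icc (v : ℝ) (p : ℝ × ℝ) (w : ℝ) :
    psiIntegrand v p w ∈ Set.Icc (0 : ℝ) 1 := by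
  unfold psiIntegrand
  split_ifs <;> simp [stdNormalCDF_nonneg, stdNormalCDF_le_one]

lemma measurable_psiIntegrand (v : ℝ) (p : ℝ × ℝ) : Measurable (psiIntegrand v p) := by
  have hq : Measurable fun w ↦ (stdNormalQuantile w).toReal :=
    measurable_ereal_toReal.comp stdNormalQuantile_mono.measurable
  unfold psiIntegrand
  split_ifs
  · exact Measurable.ite measurableSet_Iio measurable_const measurable_const
  · exact continuous_stdNormalCDF_coe.measurable.comp (by fun_prop)

/-- Extended and real arithmetic agree wherever the quantile of w is finite, hence on (0,u] except
perhaps at w = 1. Positivity of s rules out the branch u * v on the diagonal. -/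
lemma psi_eq_integral_psiIntegrand {s t u v : ℝ} (hs : 0 < s) (hu : u ∈ Set.Icc (0 : ℝ) 1)
    (hv : v ∈ Set.Ioo (0 : ℝ) 1) :
    psi s t u v = ∫ w in (0 : ℝ)..u, psiIntegrand v (s, t) w := by
  obtain ⟨a, ha, -⟩ := exists_stdNormalQuantile_eq hv
  rcases eq_or_ne s t with rfl | hst
  · have : ∀ w, psiIntegrand v (s, s) w = (Set.Iio v).indicator 1 w := fun w ↦ by
      simp [psiIntegrand, Set.indicator]
    simp_rw [this]
    rw [intervalIntegral.integral_of_le hu.1, integral_indicator measurableSet_Iio,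
      Measure.restrict_restrict measurableSet_Iio]
    have hset : (Set.Iio v ∩ Set.Ioc 0 u : Set ℝ) =ᵐ[volume] Set.Ioc 0 (min u v) := by
      filter_upwards [Measure.ae_ne volume v] with w hw
      refine propext ?_
      change (w < v ∧ 0 < w ∧ w ≤ u) ↔ (0 < w ∧ w ≤ min u v)
      rw [le_min_iff, hw.le_iff_lt]
      tauto
    rw [setIntegral_congr_set hset]
    simp [psi, hs, le_min hu.1 hv.1.le]
  · have h : 0 < |t - s| := abs_pos.2 (sub_ne_zero.2 hst.symm)
    rw [psi, if_pos h]
    refine intervalIntegral.integral_congr_ae ?_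
    filter_upwards [Measure.ae_ne volume (1 : ℝ)] with w hw1 hw
    rw [Set.uIoc_of_le hu.1] at hw
    obtain ⟨b, hb, -⟩ := exists_stdNormalQuantile_eq
      (p := w) ⟨hw.1, lt_of_le_of_ne (hw.2.trans hu.2) hw1⟩
    simp only [psiIntegrand, hst, if_false, ha, hb, EReal.toReal_coe]
    norm_cast

/-- Near (r,r) the numerator tends to √r (Φ⁻¹(v) - Φ⁻¹(w)), nonzero because w ≠ v, while the
denominator tends to 0 from above. Thus Φ tends to 1 or 0, the value prescribed on the diagonal. -/
lemma continuousAt_psiIntegrand {v w : ℝ} (hv : v ∈ Set.Ioo (0 : ℝ) 1)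
    (hw : w ∈ Set.Ioo (0 : ℝ) 1) (hvw : w ≠ v) {p : ℝ × ℝ} (hp : 0 < p.1) :
    ContinuousAt (fun p ↦ psiIntegrand v p w) p := by
  obtain ⟨a, ha, ha'⟩ := exists_stdNormalQuantile_eq hv
  obtain ⟨b, hb, hb'⟩ := exists_stdNormalQuantile_eq hw
  have hnum : Continuous fun p : ℝ × ℝ ↦ √(max p.2 p.1) * a - √(min p.1 p.2) * b := by fun_prop
  have hden : Continuous fun p : ℝ × ℝ ↦ √|p.2 - p.1| := by fun_prop
  by_cases hd : p.1 = p.2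
  · obtain ⟨r, r'⟩ := p
    obtain rfl : r = r' := hd
    have hden0 : Tendsto (fun p : ℝ × ℝ ↦ (√|p.2 - p.1|)⁻¹)
        (𝓝 (r, r) ⊓ 𝓟 {p | p.1 ≠ p.2}) atTop := by
      refine tendsto_inv_nhdsGT_zero.comp (tendsto_nhdsWithin_iff.2 ⟨?_, ?_⟩)
      · have := hden.tendsto (r, r)
        simp only [sub_self, abs_zero, Real.sqrt_zero] at this
        exact this.mono_left inf_le_left
      · refine eventually_inf_principal.2 (Eventually.of_forall fun p hp ↦ ?_)
        exact Real.sqrt_pos.2 (abs_pos.2 (sub_ne_zero.2 (Ne.symm hp)))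
    have hnum0 := (hnum.tendsto (r, r)).mono_left (inf_le_left (b := 𝓟 {p | p.1 ≠ p.2}))
    simp only [max_self, min_self, ← mul_sub] at hnum0
    have hr : 0 < √r := Real.sqrt_pos.2 hp
    have hlim : Tendsto (fun p ↦ psiIntegrand v p w) (𝓝 (r, r) ⊓ 𝓟 {p | p.1 ≠ p.2})
        (𝓝 (psiIntegrand v (r, r) w)) := by
      have heq : (fun p : ℝ × ℝ ↦ stdNormalCDF (((√(max p.2 p.1) * a - √(min p.1 p.2) * b) *
          (√|p.2 - p.1|)⁻¹ : ℝ) : EReal)) =ᶠ[𝓝 (r, r) ⊓ 𝓟 {p | p.1 ≠ p.2}]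
          fun p ↦ psiIntegrand v p w := by
        refine eventually_inf_principal.2 (Eventually.of_forall fun p hp ↦ ?_)
        simp only [psiIntegrand, if_neg hp, ha, hb, EReal.toReal_coe, div_eq_mul_inv]
      refine Tendsto.congr' heq ?_
      rcases lt_or_gt_of_ne hvw with h | h
      · have hab : b < a := by
          by_contra! hle
          have := stdNormalCDF_mono (EReal.coe_le_coe_iff.2 hle)
          linarith
        simp only [psiIntegrand, if_true, if_pos h]
        exact tendsto_stdNormalCDF_atTop.comp
          (Tendsto.pos_mul_atTop (mul_pos hr (sub_pos.2 hab)) hnum0 hden0)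
      · have hab : a < b := by
          by_contra! hle
          have := stdNormalCDF_mono (EReal.coe_le_coe_iff.2 hle)
          linarith
        simp only [psiIntegrand, if_true, if_neg h.not_gt]
        exact tendsto_stdNormalCDF_atBot.comp
          (Tendsto.neg_mul_atTop (mul_neg_of_pos_of_neg hr (sub_neg.2 hab)) hnum0 hden0)
    have hdiag : Tendsto (fun p ↦ psiIntegrand v p w) (𝓝 (r, r) ⊓ 𝓟 {p | p.1 = p.2})
        (𝓝 (psiIntegrand v (r, r) w)) := by
      refine tendsto_const_nhds.congr' (eventually_inf_principal.2 (Eventually.of_forall ?_))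
      intro p (hp : p.1 = p.2)
      simp only [psiIntegrand, hp, if_true]
    -- The neighbourhood filter is the supremum of its traces off and on the diagonal.
    have := hlim.sup hdiag
    rw [← inf_sup_left, sup_principal] at this
    have huniv : ({p | p.1 ≠ p.2} ∪ {p | p.1 = p.2} : Set (ℝ × ℝ)) = Set.univ := by
      ext p; simp [em']
    rw [huniv, principal_univ, inf_top_eq] at this
    exact this
  · have hne : ∀ᶠ q : ℝ × ℝ in 𝓝 p, q.1 ≠ q.2 :=
      (isOpen_ne_fun continuous_fst continuous_snd).mem_nhds hd
    have hcont : ContinuousAt (fun p : ℝ × ℝ ↦ stdNormalCDF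
        (((√(max p.2 p.1) * a - √(min p.1 p.2) * b) / √|p.2 - p.1| : ℝ) : EReal)) p :=
      ContinuousAt.comp (g := fun x : ℝ ↦ stdNormalCDF x) continuous_stdNormalCDF_coe.continuousAt
        (hnum.continuousAt.div hden.continuousAt
          (Real.sqrt_pos.2 (abs_pos.2 (sub_ne_zero.2 (Ne.symm hd)))).ne')
    refine hcont.congr ?_
    filter_upwards [hne] with q hq
    simp only [psiIntegrand, if_neg hq, ha, hb, EReal.toReal_coe]

/-- `psi` is jointly continuous in the two times as long as these are positive. -/
lemma continuousOn_psi {u v : ℝ} (hu : u ∈ Set.Icc (0 : ℝ) 1) (hv : v ∈ Set.Icc (0 : ℝ) 1) :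
    ContinuousOn (fun p : ℝ × ℝ ↦ psi p.1 p.2 u v) (Set.Ioi 0 ×ˢ Set.Ioi 0) := by
  rcases eq_or_lt_of_le hv.1 with rfl | hv0
  · exact (continuousOn_const (c := (0 : ℝ))).congr fun p hp ↦
      psi_zero_right hp.2 u hu.1 hu.2
  rcases eq_or_lt_of_le hv.2 with rfl | hv1
  · exact (continuousOn_const (c := u)).congr fun p hp ↦ psi_one_right hp.2 u hu.1 hu.2
  refine ContinuousOn.congr (f := fun p ↦ ∫ w in (0 : ℝ)..u, psiIntegrand v p w) ?_
    fun p hp ↦ psi_eq_integral_psiIntegrand hp.1 hu ⟨hv0, hv1⟩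
  intro p hp
  refine ContinuousAt.continuousWithinAt ?_
  refine intervalIntegral.continuousAt_of_dominated_interval (bound := fun _ ↦ 1)
    (Eventually.of_forall fun q ↦ (measurable_psiIntegrand v q).aestronglyMeasurable)
    (Eventually.of_forall fun q ↦ Eventually.of_forall fun w _ ↦ ?_) (by simp) ?_
  · have := psiIntegrand_mem_Icc v q w
    rw [Real.norm_eq_abs, abs_le]
    constructor <;> linarith [this.1, this.2]
  · filter_upwards [Measure.ae_ne volume (1 : ℝ), Measure.ae_ne volume v] with w hw1 hwv hw
    rw [Set.uIoc_of_le hu.1] at hw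
    exact continuousAt_psiIntegrand ⟨hv0, hv1⟩ ⟨hw.1, lt_of_le_of_ne (hw.2.trans hu.2) hw1⟩ hwv
      hp.1

/-! ### Chebyshev's bound along deterministic and independent random grids. -/

/-- The variance of the square of a standard normal random variable. -/
noncomputable def varSqStdNormal : ℝ := Var[fun x : ℝ ↦ x ^ 2; gaussianReal 0 1]

lemma memLp_sq_gaussianReal (v : ℝ≥0) : MemLp (fun x : ℝ ↦ x ^ 2) 2 (gaussianReal 0 v) := by
  have h : MemLp (id : ℝ → ℝ) 4 (gaussianReal 0 v) := by exact_mod_cast memLp_id_gaussianReal 4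
  have := h.norm_rpow_div 2
  have e : (4 : ℝ≥0∞) / 2 = 2 := by
    refine (ENNReal.toReal_eq_toReal_iff' (by finiteness) (by simp)).1 ?_; norm_num
  simpa [e] using this

/-- Scaling a standard normal variable by √v multiplies the variance of its square by v². The
numerical value of the constant is never needed. -/
lemma variance_sq_gaussianReal (v : ℝ≥0) :
    Var[fun x : ℝ ↦ x ^ 2; gaussianReal 0 v] = varSqStdNormal * v ^ 2 := by
  have hmap : (gaussianReal 0 1).map (fun x ↦ √v * x) = gaussianReal 0 v := by
    rw [gaussianReal_map_const_mul]
    congr 1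
    · simp
    · ext; simp
  rw [← hmap, variance_map (by fun_prop) (by fun_prop)]
  have : (fun x : ℝ ↦ x ^ 2) ∘ (fun x ↦ √(v : ℝ) * x) = fun x ↦ (v : ℝ) * x ^ 2 := by
    ext x
    simp [mul_pow]
  rw [this, variance_const_mul, varSqStdNormal, mul_comm]

lemma integral_sq_gaussianReal (v : ℝ≥0) : ∫ x, x ^ 2 ∂gaussianReal 0 v = v := by
  have h := variance_id_gaussianReal (μ := 0) (v := v)
  rw [variance_of_integral_eq_zero (by fun_prop) (by simp)] at h
  simpa using h

variable {Ω : Type*} {mΩ : MeasurableSpace Ω} {P : Measure Ω} {W : ℝ≥0 → Ω → ℝ}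

/-- Chebyshev's bound for the quadratic variation of Brownian motion along a finite grid. -/
lemma measure_sum_sq_increments_le [IsProbabilityMeasure P] (hW : IsPreBrownianReal W P)
    {τ : ℕ → ℝ≥0} (hτ : Monotone τ) (N : ℕ) {η : ℝ} (hη : 0 < η) :
    P {ω | η ≤ |∑ i ∈ Finset.range N, (W (τ (i + 1)) ω - W (τ i) ω) ^ 2 -
        ((τ N : ℝ) - τ 0)|} ≤
      ENNReal.ofReal (varSqStdNormal *
        (∑ i ∈ Finset.range N, ((τ (i + 1) : ℝ) - τ i) ^ 2) / η ^ 2) := by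
  set Y : ℕ → Ω → ℝ := fun i ω ↦ (W (τ (i + 1)) ω - W (τ i) ω) ^ 2 with hY
  have hlaw : ∀ i, HasLaw (W (τ (i + 1)) - W (τ i)) (gaussianReal 0 (τ (i + 1) - τ i)) P := by
    intro i
    have := hW.hasLaw_sub (τ (i + 1)) (τ i)
    have e : nndist (τ (i + 1)).1 (τ i).1 = τ (i + 1) - τ i := by
      ext
      rw [coe_nndist, Real.dist_eq, NNReal.coe_sub (hτ i.le_succ)]
      exact abs_of_nonneg (sub_nonneg.2 (hτ i.le_succ))
    rwa [e] at this
  have hsub : ∀ i, (((τ (i + 1) - τ i : ℝ≥0)) : ℝ) = (τ (i + 1) : ℝ) - τ i := fun i ↦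
    NNReal.coe_sub (hτ i.le_succ)
  have hL : ∀ i, MemLp (Y i) 2 P := fun i ↦ by
    have := memLp_sq_gaussianReal (τ (i + 1) - τ i)
    rw [← (hlaw i).map_eq] at this
    exact (memLp_map_measure_iff (by fun_prop) (hlaw i).aemeasurable).1 this
  have hvar : ∀ i, Var[Y i; P] = varSqStdNormal * ((τ (i + 1) : ℝ) - τ i) ^ 2 := fun i ↦ by
    rw [← hsub, ← variance_sq_gaussianReal, ← (hlaw i).map_eq,
      variance_map (by fun_prop) (hlaw i).aemeasurable]
    rfl
  have hint : ∀ i, ∫ ω, Y i ω ∂P = (τ (i + 1) : ℝ) - τ i := fun i ↦ by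
    rw [← hsub, ← integral_sq_gaussianReal, ← (hlaw i).map_eq,
      integral_map (hlaw i).aemeasurable (by fun_prop)]
    rfl
  have hind : iIndepFun (fun (i : Fin N) ω ↦ W (τ (i + 1)) ω - W (τ i) ω) P := by
    have := hW.hasIndepIncrements N (fun i ↦ τ i) (hτ.comp Fin.val_strictMono.monotone)
    simpa using this
  have hpair : (↑(Finset.range N) : Set ℕ).Pairwise fun i j ↦ IndepFun (Y i) (Y j) P := by
    intro i hi j hj hij
    have := hind.indepFun (i := ⟨i, by simpa using hi⟩) (j := ⟨j, by simpa using hj⟩)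
      (by simpa using hij)
    exact this.comp (φ := fun x : ℝ ↦ x ^ 2) (ψ := fun x : ℝ ↦ x ^ 2) (by fun_prop) (by fun_prop)
  have hcheb := meas_ge_le_variance_div_sq
    (memLp_finsetSum' (Finset.range N) fun i _ ↦ hL i) hη
  rw [IndepFun.variance_sum (fun i _ ↦ hL i) hpair] at hcheb
  have hmean : ∫ ω, (∑ i ∈ Finset.range N, Y i) ω ∂P = (τ N : ℝ) - τ 0 := by
    simp only [Finset.sum_apply]
    rw [integral_finsetSum _ fun i _ ↦ (hL i).integrable (by norm_num)]
    simp_rw [hint]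
    exact Finset.sum_range_sub (fun i ↦ (τ i : ℝ)) N
  rw [hmean] at hcheb
  simp only [hvar, ← Finset.mul_sum, Finset.sum_apply] at hcheb
  exact hcheb

/-- Freezing one of two independent random elements. -/
lemma lintegral_comp_eq_lintegral_lintegral {α β : Type*} [MeasurableSpace α]
    [MeasurableSpace β] [IsProbabilityMeasure P] {X : Ω → α} {Y : Ω → β} (hX : Measurable X)
    (hY : Measurable Y) (hind : IndepFun X Y P) {F : α × β → ℝ≥0∞} (hF : Measurable F) :
    ∫⁻ ω, F (X ω, Y ω) ∂P = ∫⁻ ω', ∫⁻ ω, F (X ω, Y ω') ∂P ∂P := by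
  have := Measure.isProbabilityMeasure_map (μ := P) hX.aemeasurable
  have := Measure.isProbabilityMeasure_map (μ := P) hY.aemeasurable
  rw [← lintegral_map (f := F) hF (hX.prodMk hY),
    (indepFun_iff_map_prod_eq_prod_map_map hX.aemeasurable hY.aemeasurable).1 hind,
    lintegral_prod_symm' _ hF, lintegral_map hF.lintegral_prod_left' hY]
  refine lintegral_congr fun ω' ↦ ?_
  rw [lintegral_map (by fun_prop) hX]

/-- Fubini: with the grid frozen, the deterministic bound applies. Writing the process as V
evaluated at a random element X turns the event into a measurable set in a product; capping by 1
later supplies domination. -/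
lemma measure_sum_sq_increments_comp_le_aux {α : Type*} [MeasurableSpace α]
    [IsProbabilityMeasure P] {V : ℝ≥0 → α → ℝ} {X : Ω → α} {τ : ℕ → Ω → ℝ≥0}
    (hV : ∀ t, Measurable (V t)) (hVc : ∀ x, Continuous fun t ↦ V t x) (hX : Measurable X)
    (hVX : IsPreBrownianReal (fun t ω ↦ V t (X ω)) P)
    (hτ : ∀ i, Measurable (τ i)) (hτm : ∀ ω, Monotone fun i ↦ τ i ω)
    (hind : IndepFun X (fun ω i ↦ τ i ω) P) (N : ℕ) {η : ℝ} (hη : 0 < η) :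
    P {ω | η ≤ |∑ i ∈ Finset.range N, (V (τ (i + 1) ω) (X ω) - V (τ i ω) (X ω)) ^ 2 -
        ((τ N ω : ℝ) - τ 0 ω)|} ≤
      ∫⁻ ω, min 1 (ENNReal.ofReal (varSqStdNormal *
        (∑ i ∈ Finset.range N, ((τ (i + 1) ω : ℝ) - τ i ω) ^ 2) / η ^ 2)) ∂P := by
  set S : Set (α × (ℕ → ℝ≥0)) := {p | η ≤ |∑ i ∈ Finset.range N,
    (V (p.2 (i + 1)) p.1 - V (p.2 i) p.1) ^ 2 - ((p.2 N : ℝ) - p.2 0)|} with hSdef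
  -- Evaluation at random times needs joint measurability, which comes from path continuity.
  have hVm := measurable_uncurry_of_continuous_of_measurable hVc hV
  have hVi : ∀ i, Measurable fun p : α × (ℕ → ℝ≥0) ↦ V (p.2 i) p.1 := fun i ↦
    hVm.comp (f := fun p : α × (ℕ → ℝ≥0) ↦ (p.2 i, p.1)) (by fun_prop)
  have hS : MeasurableSet S := by
    refine measurableSet_le measurable_const (Measurable.abs (Measurable.sub ?_ (by fun_prop)))
    exact Finset.measurable_sum _ fun i _ ↦ ((hVi _).sub (hVi _)).pow_const 2
  have hY : Measurable fun ω i ↦ τ i ω := measurable_pi_lambda _ hτ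
  have h := lintegral_comp_eq_lintegral_lintegral hX hY hind (F := S.indicator 1)
    (measurable_one.indicator hS)
  have h1 : ∫⁻ ω, S.indicator 1 (X ω, fun i ↦ τ i ω) ∂P =
      P ((fun ω ↦ (X ω, fun i ↦ τ i ω)) ⁻¹' S) :=
    lintegral_indicator_one ((hX.prodMk hY) hS)
  have h2 : ∀ ω', ∫⁻ ω, S.indicator 1 (X ω, fun i ↦ τ i ω') ∂P =
      P ((fun ω ↦ (X ω, fun i ↦ τ i ω')) ⁻¹' S) := fun ω' ↦
    lintegral_indicator_one ((hX.prodMk measurable_const) hS)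
  simp only [h1, h2] at h
  refine h.trans_le (lintegral_mono fun ω' ↦ le_min prob_le_one ?_)
  exact measure_sum_sq_increments_le hVX (hτm ω') N hη

/-- Chebyshev's bound for the quadratic variation of Brownian motion along a finite random grid
that is independent of it. -/
lemma measure_sum_sq_increments_comp_le [IsProbabilityMeasure P] (hW : IsPreBrownianReal W P)
    (hWm : ∀ t, Measurable (W t)) (hWc : ∀ ω, Continuous fun t ↦ W t ω) {τ : ℕ → Ω → ℝ≥0}
    (hτ : ∀ i, Measurable (τ i)) (hτm : ∀ ω, Monotone fun i ↦ τ i ω)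
    (hind : IndepFun (fun ω t ↦ W t ω) (fun ω i ↦ τ i ω) P) (N : ℕ) {η : ℝ} (hη : 0 < η) :
    P {ω | η ≤ |∑ i ∈ Finset.range N, (W (τ (i + 1) ω) ω - W (τ i ω) ω) ^ 2 -
        ((τ N ω : ℝ) - τ 0 ω)|} ≤
      ∫⁻ ω, min 1 (ENNReal.ofReal (varSqStdNormal *
        (∑ i ∈ Finset.range N, ((τ (i + 1) ω : ℝ) - τ i ω) ^ 2) / η ^ 2)) ∂P := by
  have hpath : Measurable fun ω t ↦ W t ω := measurable_pi_lambda _ hWm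
  -- The random element is the identity into Ω with the σ-algebra generated by W. On the space of
  -- all paths, evaluation at a varying time would not be jointly measurable.
  let m₁ : MeasurableSpace Ω := MeasurableSpace.comap (fun ω t ↦ W t ω) MeasurableSpace.pi
  have hm₁ : m₁ ≤ mΩ := hpath.comap_le
  have hWm₁ : ∀ t, Measurable[m₁] (W t) := fun t ↦
    (measurable_pi_apply t).comp (comap_measurable (fun ω t ↦ W t ω))
  have hind' : @IndepFun Ω Ω (ℕ → ℝ≥0) mΩ m₁ _ id (fun ω i ↦ τ i ω) P := by
    rw [IndepFun_iff_Indep] at hind ⊢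
    rwa [MeasurableSpace.comap_id]
  exact @measure_sum_sq_increments_comp_le_aux Ω mΩ P Ω m₁ _ W id τ hWm₁ hWc
    (fun s hs ↦ hm₁ s hs) hW hτ hτm hind' N η hη

/-! ### Consistency of the realized variation at a fixed time. -/

/-- The quadratic variation of a continuous monotone function vanishes. -/
lemma tendsto_sum_sq_increments {f : ℝ≥0 → ℝ} (hf : Continuous f) (hm : Monotone f) (t : ℝ≥0) :
    Tendsto (fun n : ℕ ↦ ∑ i ∈ Finset.range ⌊(n : ℝ≥0) * t⌋₊,
      (f (((i + 1 : ℕ) : ℝ≥0) / n) - f ((i : ℝ≥0) / n)) ^ 2) atTop (𝓝 0) := by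
  rw [Metric.tendsto_atTop]
  intro ε hε
  set K := f t - f 0 + 1 with hK
  have hKpos : 0 < K := by linarith [hm (zero_le (a := t))]
  have huc := (isCompact_Icc (a := (0 : ℝ≥0)) (b := t)).uniformContinuousOn_of_continuous
    hf.continuousOn
  obtain ⟨ρ, hρ, hρ'⟩ := Metric.uniformContinuousOn_iff.1 huc (ε / K) (div_pos hε hKpos)
  obtain ⟨n₀, hn₀⟩ := exists_nat_one_div_lt hρ
  refine ⟨n₀ + 1, fun n hn ↦ ?_⟩
  have hn0 : (0 : ℝ≥0) < n := by exact_mod_cast (Nat.succ_pos _).trans_le hn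
  have hfl : ((⌊(n : ℝ≥0) * t⌋₊ : ℕ) : ℝ≥0) ≤ n * t := Nat.floor_le (by positivity)
  have hmem : ∀ i ≤ ⌊(n : ℝ≥0) * t⌋₊, (i : ℝ≥0) / n ∈ Set.Icc 0 t := fun i hi ↦ by
    refine ⟨zero_le, ?_⟩
    rw [div_le_iff₀ hn0, mul_comm]
    exact le_trans (by exact_mod_cast hi) hfl
  have hmono : ∀ i : ℕ, f ((i : ℝ≥0) / n) ≤ f (((i + 1 : ℕ) : ℝ≥0) / n) := fun i ↦
    hm (by gcongr; simp)
  -- One factor of each square is bounded by uniform continuity; the other is kept and telescopes.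
  have hstep : ∀ i ∈ Finset.range ⌊(n : ℝ≥0) * t⌋₊,
      (f (((i + 1 : ℕ) : ℝ≥0) / n) - f ((i : ℝ≥0) / n)) ^ 2 ≤
        ε / K * (f (((i + 1 : ℕ) : ℝ≥0) / n) - f ((i : ℝ≥0) / n)) := fun i hi ↦ by
    have hi := Finset.mem_range.1 hi
    have hdist : dist (((i + 1 : ℕ) : ℝ≥0) / n) ((i : ℝ≥0) / n) < ρ := by
      rw [NNReal.dist_eq]
      push_cast
      rw [← sub_div, add_sub_cancel_left, abs_of_nonneg (by positivity)]
      refine lt_of_le_of_lt ?_ hn₀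
      gcongr
      exact_mod_cast hn
    have h1 := hρ' _ (hmem (i + 1) hi) _ (hmem i hi.le) hdist
    rw [Real.dist_eq] at h1
    rw [pow_two]
    exact mul_le_mul_of_nonneg_right ((le_abs_self _).trans h1.le) (sub_nonneg.2 (hmono i))
  rw [Real.dist_eq, sub_zero, abs_of_nonneg (Finset.sum_nonneg fun i _ ↦ sq_nonneg _)]
  calc _ ≤ ∑ i ∈ Finset.range ⌊(n : ℝ≥0) * t⌋₊,
        ε / K * (f (((i + 1 : ℕ) : ℝ≥0) / n) - f ((i : ℝ≥0) / n)) := Finset.sum_le_sum hstep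
    _ = ε / K * (f ((⌊(n : ℝ≥0) * t⌋₊ : ℝ≥0) / n) - f 0) := by
        rw [← Finset.mul_sum, Finset.sum_range_sub fun i : ℕ ↦ f ((i : ℝ≥0) / n)]
        simp
    _ ≤ ε / K * (f t - f 0) := by
        gcongr
        exact hm (hmem _ le_rfl).2
    _ < ε / K * K := by
        gcongr
        linarith
    _ = ε := div_mul_cancel₀ _ hKpos.ne'

lemma tendsto_natFloor_mul_div (t : ℝ≥0) :
    Tendsto (fun n : ℕ ↦ ((⌊(n : ℝ≥0) * t⌋₊ : ℕ) : ℝ≥0) / n) atTop (𝓝 t) := by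
  have := (tendsto_nat_floor_mul_div_atTop (R := ℝ) t.2).comp tendsto_natCast_atTop_atTop
  rw [← NNReal.tendsto_coe]
  refine this.congr fun n ↦ ?_
  simp only [Function.comp, NNReal.coe_div, NNReal.coe_natCast]
  rw [mul_comm]
  rfl

variable {T : ℝ≥0 → Ω → ℝ≥0}

/-- Pointwise consistency of the realized variation of a regular time-changed Brownian motion. -/
lemma tendsto_measure_realizedVariation_sub [IsProbabilityMeasure P]
    (hW : IsPreBrownianReal W P)
    (hWm : ∀ t, Measurable (W t)) (hWc : ∀ ω, Continuous fun t ↦ W t ω)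
    (hT : ∀ t, Measurable (T t)) (hTm : ∀ ω, Monotone fun t ↦ T t ω)
    (hTc : ∀ ω, Continuous fun t ↦ T t ω) (hT0 : ∀ ω, T 0 ω = 0)
    (hind : IndepFun (fun ω t ↦ W t ω) (fun ω t ↦ T t ω) P) (t : ℝ≥0) {η : ℝ} (hη : 0 < η) :
    Tendsto (fun n : ℕ ↦ P {ω | η ≤ |realizedVariation (fun t ω ↦ W (T t ω) ω) n t ω - T t ω|})
      atTop (𝓝 0) := by
  -- Half of η is for the Chebyshev error at the last grid point ⌊nt⌋/n, half for the gap between T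
  -- there and at t.
  have h2 : 0 < η / 2 := half_pos hη
  have hfst : Tendsto (fun n : ℕ ↦ P {ω | η / 2 ≤
      |realizedVariation (fun t ω ↦ W (T t ω) ω) n t ω -
        T (((⌊(n : ℝ≥0) * t⌋₊ : ℕ) : ℝ≥0) / n) ω|}) atTop (𝓝 0) := by
    have hbound : Tendsto (fun n : ℕ ↦ ∫⁻ ω, min 1 (ENNReal.ofReal (varSqStdNormal *
        (∑ i ∈ Finset.range ⌊(n : ℝ≥0) * t⌋₊,
          ((T (((i + 1 : ℕ) : ℝ≥0) / n) ω : ℝ) - T ((i : ℝ≥0) / n) ω) ^ 2) / (η / 2) ^ 2)) ∂P)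
        atTop (𝓝 (∫⁻ _, 0 ∂P)) := by
      -- The cap by 1 gives domination without any moment assumption on T.
      refine tendsto_lintegral_of_dominated_convergence (fun _ ↦ 1) (fun n ↦ ?_)
        (fun n ↦ ae_of_all _ fun ω ↦ min_le_left _ _) (by simp) (ae_of_all _ fun ω ↦ ?_)
      · fun_prop
      · have h := tendsto_sum_sq_increments (f := fun t ↦ (T t ω : ℝ))
          (NNReal.continuous_coe.comp (hTc ω)) (fun a b hab ↦ hTm ω hab) t
        have h' := ENNReal.tendsto_ofReal ((h.const_mul varSqStdNormal).div_const ((η / 2) ^ 2))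
        simp only [mul_zero, zero_div, ENNReal.ofReal_zero] at h'
        simpa using (tendsto_const_nhds (x := (1 : ℝ≥0∞))).min h'
    rw [lintegral_zero] at hbound
    refine tendsto_of_tendsto_of_tendsto_of_le_of_le tendsto_const_nhds hbound
      (fun _ ↦ zero_le) fun n ↦ ?_
    have hindn : IndepFun (fun ω t ↦ W t ω) (fun ω (i : ℕ) ↦ T ((i : ℝ≥0) / n) ω) P :=
      hind.comp (φ := id) (ψ := fun (f : ℝ≥0 → ℝ≥0) (i : ℕ) ↦ f ((i : ℝ≥0) / n)) measurable_id
        (measurable_pi_lambda _ fun i ↦ measurable_pi_apply _)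
    have := measure_sum_sq_increments_comp_le hW hWm hWc (τ := fun i ω ↦ T ((i : ℝ≥0) / n) ω)
      (fun i ↦ hT _) (fun ω i j hij ↦ hTm ω (by gcongr)) hindn ⌊(n : ℝ≥0) * t⌋₊ h2
    simpa only [Nat.cast_zero, zero_div, hT0, NNReal.coe_zero, sub_zero,
      realizedVariation] using this
  have hsnd : Tendsto (fun n : ℕ ↦ P {ω | η / 2 ≤
      |(T (((⌊(n : ℝ≥0) * t⌋₊ : ℕ) : ℝ≥0) / n) ω : ℝ) - T t ω|}) atTop (𝓝 (P ∅)) := by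
    refine tendsto_measure_of_ae_tendsto_indicator_of_isFiniteMeasure _ MeasurableSet.empty
      (fun n ↦ measurableSet_le measurable_const (by fun_prop)) (ae_of_all _ fun ω ↦ ?_)
    have h := (NNReal.continuous_coe.comp (hTc ω)).continuousAt.tendsto.comp
      (tendsto_natFloor_mul_div t)
    filter_upwards [Metric.tendsto_nhds.1 h (η / 2) h2] with n hn
    simp only [Set.mem_empty_iff_false, iff_false, not_le]
    simpa [Real.dist_eq] using hn
  rw [measure_empty] at hsnd
  have hsum := hfst.add hsnd
  rw [add_zero] at hsum
  refine tendsto_of_tendsto_of_tendsto_of_le_of_le tendsto_const_nhds hsum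
    (fun _ ↦ zero_le) fun n ↦ (measure_mono fun ω hω ↦ ?_).trans (measure_union_le _ _)
  by_contra hcon
  simp only [Set.mem_union, Set.mem_ofPred_eq, not_or, not_le] at hcon hω
  have := abs_sub_le (realizedVariation (fun t ω ↦ W (T t ω) ω) n t ω)
    (T (((⌊(n : ℝ≥0) * t⌋₊ : ℕ) : ℝ≥0) / n) ω) (T t ω)
  linarith

/-! ### Locally uniform convergence and the plug-in principle. -/

lemma exists_mem_Icc_succ {q : ℕ → ℝ≥0} {t : ℝ≥0} (m : ℕ) (h0 : q 0 ≤ t) (hm : t ≤ q (m + 1)) :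
    ∃ j ≤ m, t ∈ Set.Icc (q j) (q (j + 1)) := by
  induction m with
  | zero => exact ⟨0, le_rfl, h0, hm⟩
  | succ m ih =>
    rcases le_total t (q (m + 1)) with h | h
    · obtain ⟨j, hj, hj'⟩ := ih h
      exact ⟨j, hj.trans m.le_succ, hj'⟩
    · exact ⟨m + 1, le_rfl, h, hm⟩

/-- Two monotone functions that are close on a grid are close in between. -/
lemma abs_sub_lt_of_grid {f g : ℝ≥0 → ℝ} (hf : Monotone f) (hg : Monotone g) {q : ℕ → ℝ≥0} {m : ℕ}
    {η : ℝ} (hgrid : ∀ j ≤ m + 1, |g (q j) - f (q j)| < η)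
    (hstep : ∀ j ≤ m, f (q (j + 1)) - f (q j) < η) {t : ℝ≥0} (h0 : q 0 ≤ t) (hm : t ≤ q (m + 1)) :
    |g t - f t| < 2 * η := by
  obtain ⟨j, hj, hj1, hj2⟩ := exists_mem_Icc_succ m h0 hm
  have h1 := abs_lt.1 (hgrid j (by omega))
  have h2 := abs_lt.1 (hgrid (j + 1) (by omega))
  have h3 := hstep j hj
  rw [abs_lt]
  constructor <;> linarith [hf hj1, hf hj2, hg hj1, hg hj2, h1.1, h1.2, h2.1, h2.2]

/-- The uniform grid with `m + 1` cells on `[a, b]`. -/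
noncomputable def uniformGrid (a b : ℝ≥0) (m j : ℕ) : ℝ≥0 := a + j / (m + 1 : ℕ) * (b - a)

lemma uniformGrid_zero (a b : ℝ≥0) (m : ℕ) : uniformGrid a b m 0 = a := by simp [uniformGrid]

lemma uniformGrid_last {a b : ℝ≥0} (hab : a ≤ b) (m : ℕ) : uniformGrid a b m (m + 1) = b := by
  rw [uniformGrid, div_self (by positivity), one_mul, add_tsub_cancel_of_le hab]

lemma uniformGrid_mem_Icc {a b : ℝ≥0} (hab : a ≤ b) {m j : ℕ} (hj : j ≤ m + 1) :
    uniformGrid a b m j ∈ Set.Icc a b := by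
  refine ⟨le_self_add, ?_⟩
  have : (j : ℝ≥0) / (m + 1 : ℕ) ≤ 1 := div_le_one_of_le₀ (by exact_mod_cast hj) zero_le
  calc a + j / (m + 1 : ℕ) * (b - a) ≤ a + 1 * (b - a) := by gcongr
    _ = b := by rw [one_mul, add_tsub_cancel_of_le hab]

lemma dist_uniformGrid_succ (a b : ℝ≥0) (m j : ℕ) :
    dist (uniformGrid a b m (j + 1)) (uniformGrid a b m j) = ((b - a : ℝ≥0) : ℝ) / (m + 1) := by
  rw [NNReal.dist_eq]
  simp only [uniformGrid, NNReal.coe_add, NNReal.coe_mul, NNReal.coe_div, NNReal.coe_natCast]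
  push_cast
  rw [add_sub_add_left_eq_sub, ← sub_mul, ← sub_div, add_sub_cancel_left, abs_of_nonneg]
  · ring
  · positivity

lemma eventually_uniformGrid_increments_lt {f : ℝ≥0 → ℝ} (hf : Continuous f) {a b : ℝ≥0}
    (hab : a ≤ b) {η : ℝ} (hη : 0 < η) :
    ∀ᶠ m : ℕ in atTop, ∀ j ≤ m,
      f (uniformGrid a b m (j + 1)) - f (uniformGrid a b m j) < η := by
  have huc := (isCompact_Icc (a := a) (b := b)).uniformContinuousOn_of_continuous hf.continuousOn
  obtain ⟨ρ, hρ, hρ'⟩ := Metric.uniformContinuousOn_iff.1 huc η hη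
  have hlim : Tendsto (fun m : ℕ ↦ ((b - a : ℝ≥0) : ℝ) / (m + 1)) atTop (𝓝 0) := by
    simpa [div_eq_mul_inv] using
      (tendsto_one_div_add_atTop_nhds_zero_nat (𝕜 := ℝ)).const_mul ((b - a : ℝ≥0) : ℝ)
  filter_upwards [hlim.eventually (gt_mem_nhds hρ)] with m hm j hj
  have := hρ' _ (uniformGrid_mem_Icc hab (m := m) (j := j + 1) (by omega)) _
    (uniformGrid_mem_Icc hab (m := m) (j := j) (by omega)) (by rwa [dist_uniformGrid_succ])
  exact (le_abs_self _).trans_lt (by rwa [Real.dist_eq] at this)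

variable {A : ℝ≥0 → Ω → ℝ} {R : ℕ → ℝ≥0 → Ω → ℝ}

/-- For monotone processes, pointwise convergence in probability to a continuous limit is locally
uniform. -/
lemma tendsto_measure_exists_le_abs_sub [IsProbabilityMeasure P]
    (hA : ∀ t, Measurable (A t)) (hAc : ∀ ω, Continuous fun t ↦ A t ω)
    (hAm : ∀ ω, Monotone fun t ↦ A t ω) (hRm : ∀ n ω, Monotone fun t ↦ R n t ω)
    (hRA : ∀ t, ∀ η : ℝ, 0 < η → Tendsto (fun n ↦ P {ω | η ≤ |R n t ω - A t ω|}) atTop (𝓝 0))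
    {a b : ℝ≥0} (hab : a ≤ b) {η : ℝ} (hη : 0 < η) :
    Tendsto (fun n ↦ P {ω | ∃ t ∈ Set.Icc a b, η ≤ |R n t ω - A t ω|}) atTop (𝓝 0) := by
  have hη2 : 0 < η / 2 := half_pos hη
  have hstep : Tendsto (fun m : ℕ ↦ P {ω | ∃ j ≤ m, η / 2 ≤
      A (uniformGrid a b m (j + 1)) ω - A (uniformGrid a b m j) ω}) atTop (𝓝 (P ∅)) := by
    refine tendsto_measure_of_ae_tendsto_indicator_of_isFiniteMeasure _ MeasurableSet.empty
      (fun m ↦ ?_) (ae_of_all _ fun ω ↦ ?_)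
    · have : {ω | ∃ j ≤ m, η / 2 ≤ A (uniformGrid a b m (j + 1)) ω - A (uniformGrid a b m j) ω} =
          ⋃ j ∈ Set.Iic m, {ω | η / 2 ≤
            A (uniformGrid a b m (j + 1)) ω - A (uniformGrid a b m j) ω} := by
        ext ω; simp
      rw [this]
      exact MeasurableSet.biUnion (Set.to_countable _) fun j _ ↦
        measurableSet_le measurable_const ((hA _).sub (hA _))
    · filter_upwards [eventually_uniformGrid_increments_lt (hAc ω) hab hη2] with m hm
      simp only [Set.mem_empty_iff_false, iff_false]
      rintro ⟨j, hj, hj'⟩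
      exact absurd (hm j hj) (not_lt.2 hj')
  rw [measure_empty] at hstep
  rw [ENNReal.tendsto_nhds_zero]
  intro ε hε
  have hε2 : 0 < ε / 2 := ENNReal.half_pos hε.ne'
  -- The grid is fixed before n, so pointwise convergence is needed at m + 2 points only. The
  -- exceptional event need not be measurable: monotonicity and subadditivity of P suffice.
  obtain ⟨m, hm⟩ := (ENNReal.tendsto_nhds_zero.1 hstep (ε / 2) hε2).exists
  have hsum : Tendsto (fun n ↦ ∑ j ∈ Finset.range (m + 2),
      P {ω | η / 2 ≤ |R n (uniformGrid a b m j) ω - A (uniformGrid a b m j) ω|}) atTop (𝓝 0) := by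
    simpa using tendsto_finsetSum (Finset.range (m + 2)) fun j _ ↦
      hRA (uniformGrid a b m j) (η / 2) hη2
  filter_upwards [ENNReal.tendsto_nhds_zero.1 hsum (ε / 2) hε2] with n hn
  calc P {ω | ∃ t ∈ Set.Icc a b, η ≤ |R n t ω - A t ω|}
      ≤ P ({ω | ∃ j ≤ m, η / 2 ≤
          A (uniformGrid a b m (j + 1)) ω - A (uniformGrid a b m j) ω} ∪
        ⋃ j ∈ Finset.range (m + 2),
          {ω | η / 2 ≤ |R n (uniformGrid a b m j) ω - A (uniformGrid a b m j) ω|}) := by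
        refine measure_mono fun ω ⟨t, ht, hlt⟩ ↦ ?_
        by_contra hcon
        simp only [Set.mem_union, Set.mem_ofPred_eq, Set.mem_iUnion, not_or, not_exists,
          not_and, not_le, exists_prop, Finset.mem_range] at hcon
        have := abs_sub_lt_of_grid (hAm ω) (hRm n ω) (fun j hj ↦ hcon.2 j (by omega))
          hcon.1 (t := t) (by rw [uniformGrid_zero]; exact ht.1) (by rw [uniformGrid_last hab]; exact ht.2)
        linarith
    _ ≤ ε / 2 + ε / 2 := (measure_union_le _ _).trans
        (add_le_add hm ((measure_biUnion_finset_le _ _).trans hn))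
    _ = ε := ENNReal.add_halves ε

/-- A plug-in principle: locally uniform convergence in probability is preserved by a function
of two time points that is continuous on the positive quadrant. -/
lemma tendsto_measure_exists_le_abs_sub_comp [IsProbabilityMeasure P] {ψ : ℝ × ℝ → ℝ}
    (hψ : ContinuousOn ψ (Set.Ioi 0 ×ˢ Set.Ioi 0))
    (hA : ∀ t, Measurable (A t)) (hAm : ∀ ω, Monotone fun t ↦ A t ω) {a b : ℝ≥0}
    (hRA : ∀ η : ℝ, 0 < η →
      Tendsto (fun n ↦ P {ω | ∃ t ∈ Set.Icc a b, η ≤ |R n t ω - A t ω|}) atTop (𝓝 0))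
    (hpos : ∀ᵐ ω ∂P, 0 < A a ω) {ε : ℝ} (hε : 0 < ε) :
    Tendsto (fun n ↦ P {ω | ∃ s ∈ Set.Icc a b, ∃ t ∈ Set.Icc a b,
      ε ≤ |ψ (A s ω, A t ω) - ψ (R n s ω, R n t ω)|}) atTop (𝓝 0) := by
  have hbdd : Tendsto (fun k : ℕ ↦ P ({ω | A a ω ≤ 1 / ((k : ℝ) + 1)} ∪ {ω | (k : ℝ) ≤ A b ω}))
      atTop (𝓝 (P ∅)) := by
    refine tendsto_measure_of_ae_tendsto_indicator_of_isFiniteMeasure _ MeasurableSet.empty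
      (fun k ↦ (measurableSet_le (hA a) measurable_const).union
        (measurableSet_le measurable_const (hA b))) ?_
    filter_upwards [hpos] with ω hω
    filter_upwards [(tendsto_one_div_add_atTop_nhds_zero_nat (𝕜 := ℝ)).eventually
      (gt_mem_nhds hω), tendsto_natCast_atTop_atTop.eventually (eventually_gt_atTop (A b ω))]
      with k hk hk'
    simp only [Set.mem_union, Set.mem_ofPred_eq, Set.mem_empty_iff_false, iff_false, not_or, not_le]
    exact ⟨hk, hk'⟩
  rw [measure_empty] at hbdd
  rw [ENNReal.tendsto_nhds_zero]
  intro δ hδ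
  have hδ2 : 0 < δ / 2 := ENNReal.half_pos hδ.ne'
  obtain ⟨k, hk⟩ := (ENNReal.tendsto_nhds_zero.1 hbdd (δ / 2) hδ2).exists
  set α : ℝ := 1 / ((k : ℝ) + 1) with hα
  have hαpos : 0 < α := by positivity
  have hK : IsCompact (Set.Icc (α / 2) (k + 1 : ℝ) ×ˢ Set.Icc (α / 2) (k + 1 : ℝ)) :=
    isCompact_Icc.prod isCompact_Icc
  have hsub : ∀ x ∈ Set.Icc (α / 2) (k + 1 : ℝ), x ∈ Set.Ioi (0 : ℝ) := fun x hx ↦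
    lt_of_lt_of_le (half_pos hαpos) hx.1
  obtain ⟨ρ, hρ, hρ'⟩ := Metric.uniformContinuousOn_iff.1
    (hK.uniformContinuousOn_of_continuous
      (hψ.mono (Set.prod_mono (fun x hx ↦ hsub x hx) (fun x hx ↦ hsub x hx)))) ε hε
  -- The bound ρ serves uniform continuity of ψ; α/2 and 1 keep R in [α/2, k+1] when A lies in (α,
  -- k).
  set η := min ρ (min (α / 2) 1) with hηdef
  have hη : 0 < η := lt_min hρ (lt_min (half_pos hαpos) one_pos)
  filter_upwards [ENNReal.tendsto_nhds_zero.1 (hRA η hη) (δ / 2) hδ2] with n hn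
  refine (measure_mono ?_).trans ((measure_union_le _ _).trans (add_le_add hk hn)) |>.trans_eq
    (ENNReal.add_halves δ)
  rintro ω ⟨s, hs, t, ht, hst⟩
  by_contra hcon
  simp only [Set.mem_union, Set.mem_ofPred_eq, not_or, not_exists, not_and, not_le] at hcon
  obtain ⟨⟨h1, h2⟩, h3⟩ := hcon
  have hArange : ∀ r ∈ Set.Icc a b, α < A r ω ∧ A r ω < k := fun r hr ↦
    ⟨h1.trans_le (hAm ω hr.1), (hAm ω hr.2).trans_lt h2⟩
  have hAK : ∀ r ∈ Set.Icc a b, A r ω ∈ Set.Icc (α / 2) (k + 1 : ℝ) := fun r hr ↦ by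
    have := hArange r hr
    constructor <;> linarith [this.1, this.2]
  have hRK : ∀ r ∈ Set.Icc a b, R n r ω ∈ Set.Icc (α / 2) (k + 1 : ℝ) := fun r hr ↦ by
    have h4 := hArange r hr
    have h5 := abs_lt.1 (h3 r hr)
    have h6 : η ≤ α / 2 := (min_le_right _ _).trans (min_le_left _ _)
    have h7 : η ≤ 1 := (min_le_right _ _).trans (min_le_right _ _)
    constructor <;> linarith [h4.1, h4.2, h5.1, h5.2]
  have hd : ∀ r ∈ Set.Icc a b, dist (A r ω) (R n r ω) < ρ := fun r hr ↦ by
    rw [dist_comm, Real.dist_eq]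
    exact (h3 r hr).trans_le (min_le_left _ _)
  have := hρ' (A s ω, A t ω) ⟨hAK s hs, hAK t ht⟩ (R n s ω, R n t ω) ⟨hRK s hs, hRK t ht⟩
    (by rw [Prod.dist_eq]; exact max_lt (hd s hs) (hd t ht))
  rw [Real.dist_eq] at this
  exact absurd hst (not_le.2 this)

/-! ### Monotonicity of the realized variation and regular versions of the processes. -/

lemma realizedVariation_mono (Z : ℝ≥0 → Ω → ℝ) (n : ℕ) (ω : Ω) :
    Monotone fun t ↦ realizedVariation Z n t ω := fun s t hst ↦
  Finset.sum_le_sum_of_subset_of_nonneg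
    (Finset.range_mono (Nat.floor_mono (by gcongr))) fun _ _ _ ↦ sq_nonneg _

/-- A process with almost surely continuous paths is indistinguishable from a measurable one all
of whose paths are continuous. -/
lemma exists_measurable_continuous_version {W : ℝ≥0 → Ω → ℝ} (hW : ∀ t, AEMeasurable (W t) P)
    (hWc : ∀ᵐ ω ∂P, Continuous fun t ↦ W t ω) :
    ∃ W' : ℝ≥0 → Ω → ℝ, (∀ t, Measurable (W' t)) ∧ (∀ ω, Continuous fun t ↦ W' t ω) ∧
      ∀ᵐ ω ∂P, ∀ t, W t ω = W' t ω := by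
  classical
  set d := TopologicalSpace.denseSeq ℝ≥0
  have hgood : ∀ᵐ ω ∂P, Continuous (fun t ↦ W t ω) ∧
      ∀ k, W (d k) ω = (hW (d k)).mk (W (d k)) ω :=
    hWc.and (ae_all_iff.2 fun k ↦ (hW (d k)).ae_eq_mk)
  obtain ⟨G, hGsub, hGm, hG⟩ := exists_measurable_superset_of_null (ae_iff.1 hgood)
  have hGc : ∀ ω, ω ∉ G → Continuous (fun t ↦ W t ω) ∧
      ∀ k, W (d k) ω = (hW (d k)).mk (W (d k)) ω := fun ω hω ↦ by
    by_contra h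
    exact hω (hGsub h)
  have hcont : ∀ ω, Continuous fun t ↦ Gᶜ.indicator (W t) ω := fun ω ↦ by
    by_cases hω : ω ∈ G
    · simpa [hω] using continuous_const
    · simpa [hω] using (hGc ω hω).1
  refine ⟨fun t ↦ Gᶜ.indicator (W t), fun t ↦ ?_, hcont, ?_⟩
  -- One null set handles the measurable modifications at countably many dense times; other times
  -- follow by path continuity.
  · have hdm : ∀ k, Measurable (Gᶜ.indicator (W (d k))) := fun k ↦ by
      have : Gᶜ.indicator (W (d k)) = Gᶜ.indicator ((hW (d k)).mk (W (d k))) :=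
        Set.indicator_congr fun ω hω ↦ (hGc ω hω).2 k
      rw [this]
      exact (hW (d k)).measurable_mk.indicator hGm.compl
    obtain ⟨x, hx, hxt⟩ := mem_closure_iff_seq_limit.1
      (TopologicalSpace.denseRange_denseSeq ℝ≥0 t)
    refine measurable_of_tendsto_metrizable (f := fun j ↦ Gᶜ.indicator (W (x j))) (fun j ↦ ?_)
      (tendsto_pi_nhds.2 fun ω ↦ ((hcont ω).tendsto t).comp hxt)
    obtain ⟨k, hk⟩ := hx j
    simpa only [← hk] using hdm k
  · filter_upwards [measure_eq_zero_iff_ae_notMem.1 hG] with ω hω t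
    simp [hω]

/-- A finite continuous time change is indistinguishable from a measurable one all of whose paths
are finite, continuous, non-decreasing and start at zero. -/
lemma exists_regular_timeChange {T : ℝ≥0 → Ω → ℝ≥0∞} (hT : ∀ t, Measurable (T t))
    (hTm : ∀ᵐ ω ∂P, Monotone fun t ↦ T t ω) (hTc : ∀ᵐ ω ∂P, Continuous fun t ↦ T t ω)
    (hT0 : ∀ᵐ ω ∂P, T 0 ω = 0) (hTf : ∀ᵐ ω ∂P, ∀ t, T t ω < ∞) :
    ∃ T' : ℝ≥0 → Ω → ℝ≥0, (∀ t, Measurable (T' t)) ∧ (∀ ω, Continuous fun t ↦ T' t ω) ∧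
      (∀ ω, Monotone fun t ↦ T' t ω) ∧ (∀ ω, T' 0 ω = 0) ∧
      ∀ᵐ ω ∂P, ∀ t, T t ω = T' t ω := by
  classical
  have hgood := (hTm.and hTc).and (hT0.and hTf)
  obtain ⟨G, hGsub, hGm, hG⟩ := exists_measurable_superset_of_null (ae_iff.1 hgood)
  have hGc : ∀ ω, ω ∉ G → ((Monotone fun t ↦ T t ω) ∧ Continuous fun t ↦ T t ω) ∧
      T 0 ω = 0 ∧ ∀ t, T t ω < ∞ := fun ω hω ↦ by
    by_contra h
    exact hω (hGsub h)
  refine ⟨fun t ↦ Gᶜ.indicator fun ω ↦ (T t ω).toNNReal,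
    fun t ↦ (hT t).ennreal_toNNReal.indicator hGm.compl, fun ω ↦ ?_, fun ω ↦ ?_, fun ω ↦ ?_, ?_⟩
  · by_cases hω : ω ∈ G
    · simpa [hω] using continuous_const
    · simp only [Set.mem_compl_iff, hω, not_false_eq_true, Set.indicator_of_mem]
      exact ENNReal.continuousOn_toNNReal.comp_continuous (hGc ω hω).1.2
        fun t ↦ ((hGc ω hω).2.2 t).ne
  · by_cases hω : ω ∈ G
    · simpa [hω] using monotone_const
    · simp only [Set.mem_compl_iff, hω, not_false_eq_true, Set.indicator_of_mem]
      exact fun s t hst ↦ ENNReal.toNNReal_mono ((hGc ω hω).2.2 t).ne ((hGc ω hω).1.1 hst)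
  · by_cases hω : ω ∈ G
    · simp [hω]
    · simp [hω, (hGc ω hω).2.1]
  · filter_upwards [measure_eq_zero_iff_ae_notMem.1 hG] with ω hω t
    simp [hω, ENNReal.coe_toNNReal ((hGc ω hω).2.2 t).ne]

end TimeChangedBM

/-! ### The main theorem. -/

open TimeChangedBM in
theorem theorem1 {Ω : Type*} {mΩ : MeasurableSpace Ω} (P : Measure Ω) [IsProbabilityMeasure P]
    (𝓕 : Filtration ℝ≥0 mΩ) (W : ℝ≥0 → Ω → ℝ) (T : ℝ≥0 → Ω → ℝ≥0∞)
    (hW : IsBrownianReal W P)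
    (hT : TimeChangedBM.IsContinuousTimeChange 𝓕 P T)
    (hT_zero : ∀ᵐ ω ∂P, T 0 ω = 0)
    (hT_fin : ∀ᵐ ω ∂P, ∀ t, T t ω < ∞)
    (hWT : IndepFun (fun ω t ↦ W t ω) (fun ω t ↦ T t ω) P)
    (t₀ : ℝ≥0) (ht₀ : P {ω | 0 < T t₀ ω} = 1)
    (u v : ℝ) (hu : u ∈ Set.Icc (0 : ℝ) 1) (hv : v ∈ Set.Icc (0 : ℝ) 1)
    (𝒯 : ℝ≥0) (h𝒯 : t₀ < 𝒯) (ε : ℝ) (hε : 0 < ε) :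
    Filter.Tendsto
      (fun n : ℕ ↦ P {ω | ENNReal.ofReal ε ≤
        ⨆ s ∈ Set.Icc t₀ 𝒯, ⨆ t ∈ Set.Icc t₀ 𝒯,
          ENNReal.ofReal |TimeChangedBM.condCopula T s t u v ω -
            TimeChangedBM.copulaEstimator (TimeChangedBM.timeChanged W T) n s t u v ω|})
      Filter.atTop (𝓝 0) := by
  -- The stopping time property enters through the measurability of each T t.
  have hTmeas : ∀ t, Measurable (T t) := fun t ↦ measurable_of_Iic fun c ↦ by
    induction c with
    | top => simp
    | coe c => exact 𝓕.le c _ (hT.isStoppingTime t c)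
  obtain ⟨W', hW'm, hW'c, hWW'⟩ := exists_measurable_continuous_version hW.aemeasurable hW.cont
  obtain ⟨T', hT'm, hT'c, hT'mono, hT'0, hTT'⟩ := exists_regular_timeChange hTmeas hT.monotone
    hT.continuous hT_zero hT_fin
  have hW' : IsPreBrownianReal W' P := hW.toIsPreBrownianReal.congr fun t ↦
    hWW'.mono fun ω hω ↦ hω t
  have hind : IndepFun (fun ω t ↦ W' t ω) (fun ω t ↦ T' t ω) P := by
    have hcomp := hWT.comp (φ := id) (ψ := fun (f : ℝ≥0 → ℝ≥0∞) t ↦ (f t).toNNReal)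
      measurable_id (measurable_pi_lambda _ fun t ↦ (measurable_pi_apply t).ennreal_toNNReal)
    refine hcomp.congr (hWW'.mono fun ω hω ↦ funext hω) (hTT'.mono fun ω hω ↦ funext fun t ↦ ?_)
    simp [hω t]
  have hpos : ∀ᵐ ω ∂P, 0 < (T' t₀ ω : ℝ) := by
    have h : ∀ᵐ ω ∂P, 0 < T t₀ ω :=
      (mem_ae_iff_prob_eq_one (measurableSet_lt measurable_const (hTmeas t₀))).2 ht₀
    filter_upwards [h, hTT'] with ω h1 h2
    rw [h2] at h1
    exact_mod_cast h1
  -- A supremum of at least ε need not be attained, but it forces some value to be at least ε/2.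
  have hunif := tendsto_measure_exists_le_abs_sub_comp (ε := ε / 2) (continuousOn_psi hu hv)
    (fun t ↦ (hT'm t).coe_nnreal_real) (fun ω s t hst ↦ hT'mono ω hst)
    (fun η hη ↦ tendsto_measure_exists_le_abs_sub (P := P)
      (R := realizedVariation fun t ω ↦ W' (T' t ω) ω)
      (fun t ↦ (hT'm t).coe_nnreal_real) (fun ω ↦ NNReal.continuous_coe.comp (hT'c ω))
      (fun ω s t hst ↦ hT'mono ω hst) (realizedVariation_mono _)
      (fun t η hη ↦ tendsto_measure_realizedVariation_sub hW' hW'm hW'c hT'm hT'mono hT'c hT'0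
        hind t hη) h𝒯.le hη) hpos (half_pos hε)
  refine tendsto_of_tendsto_of_tendsto_of_le_of_le tendsto_const_nhds hunif
    (fun _ ↦ zero_le) fun n ↦ measure_mono_ae ?_
  filter_upwards [hWW', hTT'] with ω h1 h2 hω
  by_contra hcon
  change ¬ ∃ s ∈ Set.Icc t₀ 𝒯, ∃ t ∈ Set.Icc t₀ 𝒯, ε / 2 ≤ |psi (T' s ω) (T' t ω) u v -
    psi (realizedVariation (fun t ω ↦ W' (T' t ω) ω) n s ω)
      (realizedVariation (fun t ω ↦ W' (T' t ω) ω) n t ω) u v| at hcon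
  push Not at hcon
  have hX : ∀ t, timeChanged W T t ω = W' (T' t ω) ω := fun t ↦ by
    simp [timeChanged, h1, h2]
  have hle : (⨆ s ∈ Set.Icc t₀ 𝒯, ⨆ t ∈ Set.Icc t₀ 𝒯,
      ENNReal.ofReal |condCopula T s t u v ω -
        copulaEstimator (timeChanged W T) n s t u v ω|) ≤ ENNReal.ofReal (ε / 2) := by
    refine iSup₂_le fun s hs ↦ iSup₂_le fun t ht ↦ ENNReal.ofReal_le_ofReal ?_
    have := (hcon s hs t ht).le
    simpa only [condCopula, copulaEstimator, realizedVariation, hX, h2, ENNReal.coe_toReal]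
      using this
  have hlt : ENNReal.ofReal (ε / 2) < ENNReal.ofReal ε :=
    (ENNReal.ofReal_lt_ofReal_iff hε).2 (half_lt_self hε)
  exact absurd (le_trans hω hle) (not_le.2 hlt)
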